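/- Let $1\le\mu\le n$ be integers and let $P(z)=a_nz^n+\sum_{j=\mu}^{n}a_{n-j}z^{n-j}$ be a complex polynomial of degree $n$ having all its zeros in $|z|\le k$, where $0<k\le 1$. Put $m=\min_{|z|=k}|P(z)|$ and, for $\alpha\in\mathbb C$, let $D_\alpha P(z)=nP(z)+(\alpha-z)P'(z)$ be the polar derivative of $P$. Then for every $\alpha\in\mathbb C$ with $|\alpha|\ge k^{\mu}$ the following hold. (a) For every $\beta\in\mathbb C$ with $|\beta|\le1$ and every $p>0$, $$n(|\alpha|-k^\mu)\Big(\int_0^{2\pi}\Big|P(e^{i\theta})+\frac{m\beta}{k^{n-\mu}}\Big|^p\,d\theta\Big)^{1/p}\le\Big(\int_0^{2\pi}|1+k^\mu e^{i\theta}|^p\,d\theta\Big)^{1/p}\Big(\max_{|z|=1}|D_\alpha P(z)|-\frac{nm}{k^{n-\mu}}\Big).$$ (b) For every $\beta\in\mathbb C$ with $|\beta|\le1$, the two sides of the inequality in (a), multiplied by $(2\pi)^{-1/p}$, converge as $p\to\infty$ to the corresponding sides of $$n(|\alpha|-k^\mu)\max_{|z|=1}\Big|P(z)+\frac{m\beta}{k^{n-\mu}}\Big|\le(1+k^\mu)\Big(\max_{|z|=1}|D_\alpha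 P(z)|-\frac{nm}{k^{n-\mu}}\Big),$$ which therefore holds. (c) Consequently, $$n(|\alpha|-k^\mu)\max_{|z|=1}|P(z)|+\frac{n(|\alpha|-k)}{k^{n-\mu}}\min_{|z|=k}|P(z)|\le(1+k^\mu)\max_{|z|=1}|D_\alpha P(z)|.$$ -/

import Mathlib

open Polynomial Filter Topology

/-- The polar derivative `D_α P(z) = n P(z) + (α - z) P'(z)`, where `n` is the degree of `P`. -/
noncomputable def polarDeriv (α : ℂ) (P : ℂ[X]) : ℂ[X] :=
  C (P.natDegree : ℂ) * P + (C α - X) * derivative P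

/-- `max_{|z| = r} |P(z)|` (for `r ≥ 0`). -/
noncomputable def maxModulus (P : ℂ[X]) (r : ℝ) : ℝ :=
  sSup ((fun z : ℂ => ‖P.eval z‖) '' Metric.sphere (0 : ℂ) r)

/-- `min_{|z| = r} |P(z)|` (for `r ≥ 0`). -/
noncomputable def minModulus (P : ℂ[X]) (r : ℝ) : ℝ :=
  sInf ((fun z : ℂ => ‖P.eval z‖) '' Metric.sphere (0 : ℂ) r)

/-- `(∫₀^{2π} |P(e^{iθ})|^p dθ)^{1/p}`, without normalizing factor. -/
noncomputable def circleLp (p : ℝ) (P : ℂ[X]) : ℝ :=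
  (∫ θ in (0 : ℝ)..(2 * Real.pi), ‖P.eval (Complex.exp (θ * Complex.I))‖ ^ p) ^ (1 / p)

theorem isCompact_modulus_image (P : ℂ[X]) (r : ℝ) :
    IsCompact ((fun z : ℂ => ‖P.eval z‖) '' Metric.sphere (0 : ℂ) r) :=
  (isCompact_sphere 0 r).image P.continuous.norm

theorem nonempty_modulus_image (P : ℂ[X]) {r : ℝ} (hr : 0 ≤ r) :
    ((fun z : ℂ => ‖P.eval z‖) '' Metric.sphere (0 : ℂ) r).Nonempty :=
  (NormedSpace.sphere_nonempty.mpr hr).image _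

/-- The supremum in `maxModulus` is a maximum. -/
theorem maxModulus_isGreatest (P : ℂ[X]) {r : ℝ} (hr : 0 ≤ r) :
    IsGreatest ((fun z : ℂ => ‖P.eval z‖) '' Metric.sphere (0 : ℂ) r) (maxModulus P r) :=
  (isCompact_modulus_image P r).isGreatest_sSup (nonempty_modulus_image P hr)

/-- The infimum in `minModulus` is a minimum. -/
theorem minModulus_isLeast (P : ℂ[X]) {r : ℝ} (hr : 0 ≤ r) :
    IsLeast ((fun z : ℂ => ‖P.eval z‖) '' Metric.sphere (0 : ℂ) r) (minModulus P r) :=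
  (isCompact_modulus_image P r).isLeast_sInf (nonempty_modulus_image P hr)

/-! The proof combines a pointwise bound on `|z| = 1` with a subordination argument. Pointwise:
`G(z) = z^n P(k/z)` has no zeros in the open disc, so `Re (zG'/G) ≤ n/2`, that is `|zG'| ≤ |nG -
zG'|`. The gap makes `zG'` divisible by `z^μ`, and the maximum principle gains the factor `|z|^μ`.
Since `|G| ≥ m` on the disc, `G` may be shifted by constants smaller than `m`, which subtracts `nm`
from `|nG - zG'|`. At `|z| = k` this becomes `|nP - vP'| + nm/k^(n-μ) ≤ k^μ |P'|` on `|v| = 1`, and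
`D_α P = αP' + (nP - vP')` then bounds `(|α| - k^μ)|P'|`. Integral: after reflection, `n(P + c)`
takes the form `A(1 + k^μ f)` with `|A| = |P'|` on the circle, `f(0) = 0` and `|f| ≤ 1`. Littlewood
subordination replaces `f` by `z` in the `p`-th mean. The limit `p → ∞` gives the maximum norm, and
a suitable argument of `β` gives (c). -/

/-! ### Logarithmic derivative of a polynomial without zeros in the disc -/

theorem re_div_sub_le_half {z w : ℂ} (h : ‖z‖ ≤ ‖w‖) (hzw : z ≠ w) :
    (z / (z - w)).re ≤ 1 / 2 := by
  have hpos : 0 < Complex.normSq (z - w) := Complex.normSq_pos.mpr (sub_ne_zero.mpr hzw)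
  have h2 : ‖z‖ ^ 2 ≤ ‖w‖ ^ 2 := by gcongr
  rw [← Complex.normSq_eq_norm_sq, ← Complex.normSq_eq_norm_sq, Complex.normSq_apply,
    Complex.normSq_apply] at h2
  rw [Complex.div_re, ← add_div, div_le_iff₀ hpos, Complex.normSq_apply]
  simp only [Complex.sub_re, Complex.sub_im]
  -- The difference of the two sides is `(|w|² - |z|²) / 2`.
  nlinarith

/-- The line `Re w = n/2` is the perpendicular bisector of `0` and `n`. -/
theorem norm_le_norm_natCast_sub {w : ℂ} {n : ℕ} (h : w.re ≤ n / 2) : ‖w‖ ≤ ‖(n : ℂ) - w‖ := by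
  rw [← sq_le_sq₀ (norm_nonneg _) (norm_nonneg _), ← Complex.normSq_eq_norm_sq,
    ← Complex.normSq_eq_norm_sq, Complex.normSq_apply, Complex.normSq_apply]
  simp only [Complex.sub_re, Complex.sub_im, Complex.natCast_re, Complex.natCast_im]
  have : (0 : ℝ) ≤ n := Nat.cast_nonneg n
  nlinarith

/-- If `G` has degree at most `n` and no zeros in the open unit disc, then
`Re (z G'(z) / G(z)) ≤ n / 2` there. -/
theorem re_mul_derivative_div_le {G : ℂ[X]} {n : ℕ} (hn : G.natDegree ≤ n)
    (hG : ∀ z : ℂ, ‖z‖ < 1 → G.eval z ≠ 0) {z : ℂ} (hz : ‖z‖ < 1) :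
    (z * (derivative G).eval z / G.eval z).re ≤ n / 2 := by
  have hs := IsAlgClosed.splits G
  rw [mul_div_assoc, hs.eval_derivative_div_eval_of_ne_zero (hG z hz), ← Multiset.sum_map_mul_left,
    ← Complex.reCLM_apply]
  rw [map_multiset_sum, Multiset.map_map]
  have hcard : (Multiset.card G.roots : ℝ) ≤ n := by
    exact_mod_cast (card_roots' G).trans hn
  refine (Multiset.sum_le_card_nsmul _ (1 / 2 : ℝ) ?_).trans ?_
  · intro x hx
    obtain ⟨w, hw, rfl⟩ := Multiset.mem_map.mp hx
    have hw0 : G.eval w = 0 := (mem_roots'.mp hw).2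
    have hw1 : 1 ≤ ‖w‖ := by
      by_contra! hlt
      exact hG w hlt hw0
    have := re_div_sub_le_half (z := z) (w := w) (by linarith) (by
      rintro rfl
      linarith)
    rw [Function.comp_apply, mul_one_div]
    exact this
  · rw [Multiset.card_map, nsmul_eq_mul]
    linarith

theorem norm_mul_derivative_le {G : ℂ[X]} {n : ℕ} (hn : G.natDegree ≤ n)
    (hG : ∀ z : ℂ, ‖z‖ < 1 → G.eval z ≠ 0) {z : ℂ} (hz : ‖z‖ < 1) :
    ‖z * (derivative G).eval z‖ ≤ ‖n * G.eval z - z * (derivative G).eval z‖ := by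
  have h := norm_le_norm_natCast_sub (re_mul_derivative_div_le hn hG hz)
  have h0 := hG z hz
  have h1 : (n : ℂ) - z * (derivative G).eval z / G.eval z =
      (n * G.eval z - z * (derivative G).eval z) / G.eval z := by field_simp
  rw [h1, norm_div, norm_div] at h
  exact (div_le_div_iff_of_pos_right (norm_pos_iff.mpr h0)).mp h

/-- This combination serves as a denominator, both in the Schwarz lemma and in the subordination
argument. -/
theorem natCast_mul_sub_mul_derivative_ne_zero {G : ℂ[X]} {n : ℕ} (hn0 : n ≠ 0)
    (hn : G.natDegree ≤ n) (hG : ∀ z : ℂ, ‖z‖ < 1 → G.eval z ≠ 0) {z : ℂ} (hz : ‖z‖ < 1) :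
    n * G.eval z - z * (derivative G).eval z ≠ 0 := by
  intro h
  have h1 := norm_mul_derivative_le hn hG hz
  rw [h, norm_zero, norm_le_zero_iff] at h1
  rw [h1, sub_zero] at h
  exact mul_ne_zero (Nat.cast_ne_zero.mpr hn0) (hG z hz) h

/-! ### Schwarz lemma and minimum modulus refinements -/

/-- An inequality of continuous functions extends from the open to the closed unit disc. -/
theorem le_on_closedBall_of_le_on_ball {u v : ℂ → ℝ} (hu : Continuous u) (hv : Continuous v)
    (h : ∀ z : ℂ, ‖z‖ < 1 → u z ≤ v z) {z : ℂ} (hz : ‖z‖ ≤ 1) : u z ≤ v z := by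
  have hc : IsClosed {z : ℂ | u z ≤ v z} := isClosed_le hu hv
  have hsub : Metric.ball (0 : ℂ) 1 ⊆ {z : ℂ | u z ≤ v z} := fun w hw => h w (by simpa using hw)
  have := hc.closure_subset_iff.mpr hsub
  rw [closure_ball _ one_ne_zero] at this
  exact this (by simpa using hz)

/-- A Schwarz lemma for quotients of polynomials. -/
theorem norm_eval_le_of_norm_pow_mul_le {A B : ℂ[X]} {μ : ℕ}
    (hA : ∀ z : ℂ, ‖z‖ < 1 → A.eval z ≠ 0)
    (h : ∀ z : ℂ, ‖z‖ < 1 → ‖z ^ μ * B.eval z‖ ≤ ‖A.eval z‖) {z : ℂ} (hz : ‖z‖ ≤ 1) :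
    ‖B.eval z‖ ≤ ‖A.eval z‖ := by
  refine le_on_closedBall_of_le_on_ball B.continuous.norm A.continuous.norm (fun z hz => ?_) hz
  -- `A` may vanish on the unit circle, so the maximum principle for `B / A` is applied on radius `r
  -- < 1`, and then `r → 1`.
  have key : ∀ r ∈ Set.Ioo ‖z‖ 1, r ^ μ * ‖B.eval z‖ ≤ ‖A.eval z‖ := by
    rintro r ⟨hzr, hr1⟩
    have hr0 : 0 < r := (norm_nonneg z).trans_lt hzr
    have hd : DiffContOnCl ℂ (fun w => B.eval w / A.eval w) (Metric.ball 0 r) := by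
      apply DifferentiableOn.diffContOnCl
      rw [closure_ball _ hr0.ne']
      intro w hw
      refine (B.differentiable.differentiableAt.div A.differentiable.differentiableAt
        (hA w ?_)).differentiableWithinAt
      exact lt_of_le_of_lt (by simpa using hw) hr1
    have hb : ∀ w ∈ frontier (Metric.ball (0 : ℂ) r), ‖B.eval w / A.eval w‖ ≤ (r ^ μ)⁻¹ := by
      intro w hw
      rw [frontier_ball _ hr0.ne'] at hw
      have hw' : ‖w‖ = r := by simpa using hw
      have h1 := h w (by rw [hw']; exact hr1)
      have h2 := norm_pos_iff.mpr (hA w (by rw [hw']; exact hr1))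
      rw [norm_mul, norm_pow, hw'] at h1
      rw [norm_div, div_le_iff₀ h2, ← div_eq_inv_mul, le_div_iff₀ (by positivity)]
      linarith
    have := Complex.norm_le_of_forall_mem_frontier_norm_le Metric.isBounded_ball hd hb
      (z := z) (subset_closure (by simpa using hzr))
    have h2 := norm_pos_iff.mpr (hA z hz)
    rw [norm_div, div_le_iff₀ h2, ← div_eq_inv_mul, le_div_iff₀ (by positivity)] at this
    linarith
  have ht : Tendsto (fun r : ℝ => r ^ μ * ‖B.eval z‖) (𝓝[<] 1) (𝓝 (1 ^ μ * ‖B.eval z‖)) :=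
    ((continuous_id.pow μ).mul continuous_const).continuousAt.tendsto.mono_left
      nhdsWithin_le_nhds
  rw [one_pow, one_mul] at ht
  exact le_of_tendsto ht (by
    filter_upwards [Ioo_mem_nhdsLT hz] with r hr using key r hr)

/-- If `G` has degree at most `n`, no zeros in the open unit disc, and a gap between the constant
term and the term of degree `μ`, then `|z G'(z)| ≤ |z| ^ μ |n G(z) - z G'(z)|` on the disc. -/
theorem norm_mul_derivative_le_pow_mul {G : ℂ[X]} {n μ : ℕ} (hn0 : n ≠ 0) (hn : G.natDegree ≤ n)
    (hG : ∀ z : ℂ, ‖z‖ < 1 → G.eval z ≠ 0) (hgap : ∀ j, 0 < j → j < μ → G.coeff j = 0)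
    {z : ℂ} (hz : ‖z‖ ≤ 1) :
    ‖z * (derivative G).eval z‖ ≤ ‖z‖ ^ μ * ‖n * G.eval z - z * (derivative G).eval z‖ := by
  obtain ⟨H, hH⟩ : X ^ μ ∣ X * derivative G := by
    rw [X_pow_dvd_iff]
    rintro (_ | d) hd
    · simp
    · rw [coeff_X_mul, coeff_derivative, hgap (d + 1) d.succ_pos hd, zero_mul]
  have hH' : ∀ w : ℂ, w * (derivative G).eval w = w ^ μ * H.eval w := fun w => by
    simpa using congrArg (eval w) hH
  have hA : ∀ w : ℂ, (C (n : ℂ) * G - X * derivative G).eval w =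
      n * G.eval w - w * (derivative G).eval w := fun w => by simp
  have := norm_eval_le_of_norm_pow_mul_le (A := C (n : ℂ) * G - X * derivative G) (B := H) (μ := μ)
    (fun w hw => by
      rw [hA]
      exact natCast_mul_sub_mul_derivative_ne_zero hn0 hn hG hw)
    (fun w hw => by
      rw [hA, ← hH']
      exact norm_mul_derivative_le hn hG hw) hz
  rw [hA] at this
  rw [show ‖z * (derivative G).eval z‖ = ‖z‖ ^ μ * ‖H.eval z‖ by rw [hH', norm_mul, norm_pow]]
  gcongr

/-- Minimum modulus principle on the unit disc. -/
theorem le_norm_eval_of_le_on_sphere {G : ℂ[X]} {δ : ℝ}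
    (hG : ∀ z : ℂ, ‖z‖ < 1 → G.eval z ≠ 0) (hδ : ∀ z : ℂ, ‖z‖ = 1 → δ ≤ ‖G.eval z‖)
    {z : ℂ} (hz : ‖z‖ ≤ 1) : δ ≤ ‖G.eval z‖ := by
  rcases le_or_gt δ 0 with h0 | h0
  · exact h0.trans (norm_nonneg _)
  have hne : ∀ w : ℂ, ‖w‖ ≤ 1 → G.eval w ≠ 0 := by
    intro w hw
    rcases hw.lt_or_eq with h | h
    · exact hG w h
    · exact norm_pos_iff.mp (h0.trans_le (hδ w h))
  have hd : DiffContOnCl ℂ (fun w => (G.eval w)⁻¹) (Metric.ball 0 1) := by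
    apply DifferentiableOn.diffContOnCl
    rw [closure_ball _ one_ne_zero]
    intro w hw
    exact (G.differentiable.differentiableAt.inv (hne w (by simpa using hw))).differentiableWithinAt
  have := Complex.norm_le_of_forall_mem_frontier_norm_le Metric.isBounded_ball hd (C := δ⁻¹)
    (fun w hw => by
      rw [frontier_ball _ one_ne_zero] at hw
      rw [norm_inv]
      exact inv_anti₀ h0 (hδ w (by simpa using hw)))
    (z := z) (by rw [closure_ball _ one_ne_zero]; simpa using hz)
  rw [norm_inv] at this
  exact (inv_le_inv₀ (norm_pos_iff.mpr (hne z hz)) h0).mp this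

/-- A refinement of `norm_mul_derivative_le_pow_mul` that takes into account a lower bound of `|G|`
on the unit circle. -/
theorem norm_mul_derivative_le_pow_mul_sub {G : ℂ[X]} {n μ : ℕ} {δ : ℝ} (hn0 : n ≠ 0)
    (hn : G.natDegree ≤ n) (hG : ∀ z : ℂ, ‖z‖ < 1 → G.eval z ≠ 0)
    (hgap : ∀ j, 0 < j → j < μ → G.coeff j = 0) (hδ0 : 0 ≤ δ)
    (hδ : ∀ z : ℂ, ‖z‖ = 1 → δ ≤ ‖G.eval z‖) {z : ℂ} (hz : ‖z‖ ≤ 1) :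
    ‖z * (derivative G).eval z‖ ≤
      ‖z‖ ^ μ * (‖n * G.eval z - z * (derivative G).eval z‖ - n * δ) := by
  have hn' : (0 : ℝ) < n := by exact_mod_cast Nat.pos_of_ne_zero hn0
  have hnC : (n : ℂ) ≠ 0 := by exact_mod_cast hn0
  refine le_on_closedBall_of_le_on_ball (u := fun z => ‖z * (derivative G).eval z‖)
    (v := fun z => ‖z‖ ^ μ * (‖n * G.eval z - z * (derivative G).eval z‖ - n * δ))
    (by fun_prop) (by fun_prop) (fun z hz => ?_) hz
  set D := n * G.eval z - z * (derivative G).eval z with hD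
  have hshift : ∀ c : ℂ, ‖c‖ < δ → ∀ w : ℂ, ‖w‖ < 1 → (G + C c).eval w ≠ 0 := by
    intro c hc w hw h
    have h1 := le_norm_eval_of_le_on_sphere hG hδ hw.le
    rw [eval_add, eval_C, add_eq_zero_iff_eq_neg] at h
    rw [h, norm_neg] at h1
    linarith
  have hdeg : ∀ c : ℂ, (G + C c).natDegree ≤ n := fun c => by rwa [natDegree_add_C]
  have hev : ∀ c : ℂ, n * (G + C c).eval z - z * (derivative (G + C c)).eval z = D + n * c := by
    intro c
    simp only [eval_add, eval_C, derivative_add, derivative_C, add_zero, hD]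
    ring
  -- Otherwise `c = -D/n` is an admissible shift for which `n(G + c) - z(G + c)'` vanishes at `z`.
  have hDδ : n * δ ≤ ‖D‖ := by
    by_contra! hlt
    have hc : ‖-(D / n)‖ < δ := by
      rw [norm_neg, norm_div, Complex.norm_natCast, div_lt_iff₀ hn']
      linarith
    apply natCast_mul_sub_mul_derivative_ne_zero hn0 (hdeg _) (hshift _ hc) hz
    rw [hev]
    field_simp
    ring
  -- The shift by `-t D/|D|` leaves `G'` unchanged and points against `D`, so it lowers `|D|` by
  -- exactly `n t`.
  have key : ∀ t ∈ Set.Ico 0 δ, ‖z * (derivative G).eval z‖ ≤ ‖z‖ ^ μ * (‖D‖ - n * t) := by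
    rintro t ⟨ht0, htδ⟩
    have hDpos : 0 < ‖D‖ := lt_of_lt_of_le (by nlinarith) hDδ
    have hDne : (‖D‖ : ℂ) ≠ 0 := by exact_mod_cast hDpos.ne'
    have hc : ‖-(t * (D / ‖D‖) : ℂ)‖ = t := by
      rw [norm_neg, norm_mul, norm_div, Complex.norm_real, Complex.norm_real, norm_norm,
        div_self hDpos.ne', mul_one, Real.norm_of_nonneg ht0]
    have := norm_mul_derivative_le_pow_mul (μ := μ) hn0 (hdeg (-(t * (D / ‖D‖))))
      (hshift _ (by rw [hc]; exact htδ)) (fun j hj hjμ => by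
        rw [coeff_add, hgap j hj hjμ, coeff_C_of_ne_zero hj.ne', add_zero]) hz.le
    rw [hev, derivative_add, derivative_C, add_zero] at this
    have h1 : D + n * -(t * (D / ‖D‖) : ℂ) = ((‖D‖ - n * t : ℝ) : ℂ) * (D / ‖D‖) := by
      push_cast
      field_simp
      ring
    rwa [h1, norm_mul ((‖D‖ - n * t : ℝ) : ℂ), norm_div, Complex.norm_real, Complex.norm_real,
      norm_norm, div_self hDpos.ne', mul_one, Real.norm_of_nonneg (by nlinarith)] at this
  rcases hδ0.eq_or_lt with h0 | h0
  · rw [← h0, mul_zero, sub_zero]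
    exact norm_mul_derivative_le_pow_mul hn0 hn hG hgap hz.le
  have ht : Tendsto (fun t : ℝ => ‖z‖ ^ μ * (‖D‖ - n * t)) (𝓝[<] δ)
      (𝓝 (‖z‖ ^ μ * (‖D‖ - n * δ))) :=
    (Continuous.tendsto (by fun_prop) δ).mono_left nhdsWithin_le_nhds
  exact ge_of_tendsto ht (by
    filter_upwards [Ioo_mem_nhdsLT h0] with t ht using key t ⟨ht.1.le, ht.2⟩)

/-! ### Circle averages and Littlewood subordination -/

theorem circleAverage_le_of_le_on_sphere {u v : ℂ → ℝ}
    (hu : ContinuousOn u (Metric.sphere 0 1)) (hv : ContinuousOn v (Metric.sphere 0 1))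
    (h : ∀ z : ℂ, ‖z‖ = 1 → u z ≤ v z) :
    Real.circleAverage u 0 1 ≤ Real.circleAverage v 0 1 :=
  Real.circleAverage_mono (hu.circleIntegrable zero_le_one) (hv.circleIntegrable zero_le_one)
    (fun z hz => h z (by simpa using hz))

/-- Dominated convergence for circle averages of continuous functions. -/
theorem tendsto_circleAverage_of_bounded {ι : Type*} {l : Filter ι} [l.IsCountablyGenerated]
    {F : ι → ℂ → ℝ} {f : ℂ → ℝ} (K : ℝ)
    (hF : ∀ᶠ i in l, ContinuousOn (F i) (Metric.sphere 0 1))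
    (hK : ∀ᶠ i in l, ∀ z : ℂ, ‖z‖ = 1 → ‖F i z‖ ≤ K)
    (hlim : ∀ z : ℂ, ‖z‖ = 1 → Tendsto (fun i => F i z) l (𝓝 (f z))) :
    Tendsto (fun i => Real.circleAverage (F i) 0 1) l (𝓝 (Real.circleAverage f 0 1)) := by
  unfold Real.circleAverage
  have hnorm : ∀ θ : ℝ, ‖circleMap 0 1 θ‖ = 1 := fun θ => by simp
  refine Tendsto.const_smul ?_ _
  refine intervalIntegral.tendsto_integral_filter_of_dominated_convergence (fun _ => K) ?_ ?_
    intervalIntegrable_const ?_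
  · filter_upwards [hF] with i hi
    have : Continuous fun θ : ℝ => F i (circleMap 0 1 θ) :=
      hi.comp_continuous (continuous_circleMap 0 1) (fun θ => by simp)
    exact this.aestronglyMeasurable
  · filter_upwards [hK] with i hi
    exact Eventually.of_forall fun θ _ => hi _ (hnorm θ)
  · exact Eventually.of_forall fun θ _ => hlim _ (hnorm θ)

theorem DiffContOnCl.continuousOn_sphere {h : ℂ → ℂ} (hh : DiffContOnCl ℂ h (Metric.ball 0 1)) :
    ContinuousOn h (Metric.sphere 0 1) := by
  have := hh.continuousOn
  rw [closure_ball _ one_ne_zero] at this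
  exact this.mono Metric.sphere_subset_closedBall

/-- The cross term `2 Re (ā h)` has mean `2 Re (ā h(0)) = 0` by the mean value property. -/
theorem circleAverage_norm_add_sq {h : ℂ → ℂ} (hh : DiffContOnCl ℂ h (Metric.ball 0 1))
    (h0 : h 0 = 0) (a : ℂ) :
    Real.circleAverage (fun z => ‖a + h z‖ ^ 2) 0 1 =
      ‖a‖ ^ 2 + Real.circleAverage (fun z => ‖h z‖ ^ 2) 0 1 := by
  have hc := hh.continuousOn_sphere
  have hci : CircleIntegrable h 0 1 := hc.circleIntegrable zero_le_one
  set L : ℂ →L[ℝ] ℝ := Complex.reCLM.comp (ContinuousLinearMap.mul ℝ ℂ (2 * starRingEnd ℂ a))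
    with hL
  have hmean : Real.circleAverage (L ∘ h) 0 1 = 0 := by
    rw [L.circleAverage_comp_comm hci]
    have : Real.circleAverage h 0 1 = h 0 := by
      apply DiffContOnCl.circleAverage
      rwa [abs_one]
    rw [this, h0, map_zero]
  have hexp : (fun z => ‖a + h z‖ ^ 2) = fun z => (‖a‖ ^ 2 + (L ∘ h) z) + ‖h z‖ ^ 2 := by
    funext z
    simp only [← Complex.normSq_eq_norm_sq, Complex.normSq_apply, hL]
    simp
    ring
  have hLc : ContinuousOn (L ∘ h) (Metric.sphere 0 1) := L.continuous.comp_continuousOn hc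
  have h1 : CircleIntegrable (fun _ : ℂ => ‖a‖ ^ 2) 0 1 :=
    continuousOn_const.circleIntegrable zero_le_one
  have h2 : CircleIntegrable (fun z => (L ∘ h) z) 0 1 := hLc.circleIntegrable zero_le_one
  have h3 : CircleIntegrable (fun z => ‖a‖ ^ 2 + (L ∘ h) z) 0 1 :=
    (continuousOn_const.add hLc).circleIntegrable zero_le_one
  have h4 : CircleIntegrable (fun z => ‖h z‖ ^ 2) 0 1 := (hc.norm.pow 2).circleIntegrable zero_le_one
  rw [hexp, Real.circleAverage_fun_add h3 h4, Real.circleAverage_fun_add h1 h2, hmean,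
    Real.circleAverage_const, add_zero]

theorem DiffContOnCl.polynomial_eval {f : ℂ → ℂ} {s : Set ℂ} (hf : DiffContOnCl ℂ f s) (g : ℂ[X]) :
    DiffContOnCl ℂ (fun z => g.eval (f z)) s :=
  g.differentiable.comp_diffContOnCl hf

/-- Littlewood's subordination principle in mean square, for polynomials. -/
theorem circleAverage_norm_eval_comp_sq_le {f : ℂ → ℂ} (hf : DiffContOnCl ℂ f (Metric.ball 0 1))
    (hf0 : f 0 = 0) (hf1 : ∀ z : ℂ, ‖z‖ = 1 → ‖f z‖ ≤ 1) (g : ℂ[X]) :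
    Real.circleAverage (fun z => ‖g.eval (f z)‖ ^ 2) 0 1 ≤
      Real.circleAverage (fun z => ‖g.eval z‖ ^ 2) 0 1 := by
  have hid : DiffContOnCl ℂ (fun z : ℂ => z) (Metric.ball 0 1) := differentiable_id.diffContOnCl
  induction hN : g.natDegree generalizing g with
  | zero =>
    obtain ⟨a, rfl⟩ := natDegree_eq_zero.mp hN
    simp
  | succ N ih =>
    -- Write `g(w) = g(0) + w q(w)`. Both means split off `|g(0)|²`; in the remainder `|f| ≤ 1`
    -- discards the factor `f`, while the factor `z` on the other side has modulus one.
    set q := g.divX with hq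
    have hg : ∀ w, g.eval w = g.coeff 0 + w * q.eval w := fun w => by
      conv_lhs => rw [← divX_mul_X_add g]
      simp only [eval_add, eval_mul, eval_X, eval_C]
      ring
    have hqd : q.natDegree = N := by rw [hq, natDegree_divX_eq_natDegree_tsub_one, hN]; rfl
    have hfq : DiffContOnCl ℂ (fun z => f z * q.eval (f z)) (Metric.ball 0 1) :=
      hf.smul (hf.polynomial_eval q)
    have hiq : DiffContOnCl ℂ (fun z : ℂ => z * q.eval z) (Metric.ball 0 1) :=
      hid.smul (hid.polynomial_eval q)
    simp only [hg]
    rw [circleAverage_norm_add_sq hfq (by rw [hf0, zero_mul]),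
      circleAverage_norm_add_sq hiq (zero_mul _)]
    gcongr 1
    · calc _ ≤ Real.circleAverage (fun z => ‖q.eval (f z)‖ ^ 2) 0 1 := by
            refine circleAverage_le_of_le_on_sphere (hfq.continuousOn_sphere.norm.pow 2)
              ((hf.polynomial_eval q).continuousOn_sphere.norm.pow 2) (fun z hz => ?_)
            rw [norm_mul]
            have := mul_le_of_le_one_left (norm_nonneg (q.eval (f z))) (hf1 z hz)
            gcongr
        _ ≤ Real.circleAverage (fun z => ‖q.eval z‖ ^ 2) 0 1 := ih q hqd
        _ ≤ _ := by
            refine circleAverage_le_of_le_on_sphere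
              ((hid.polynomial_eval q).continuousOn_sphere.norm.pow 2)
              (hiq.continuousOn_sphere.norm.pow 2) (fun z hz => ?_)
            rw [norm_mul, hz, one_mul]

/-- On the closed unit disc, `(1 + t z) ^ a` is a uniform limit of polynomials if `t < 1`. -/
theorem exists_polynomial_tendstoUniformlyOn_one_add_cpow (a : ℂ) {t : ℝ} (ht0 : 0 ≤ t)
    (ht1 : t < 1) :
    ∃ g : ℕ → ℂ[X], TendstoUniformlyOn (fun N z => (g N).eval z)
      (fun z => (1 + (t : ℂ) * z) ^ a) atTop (Metric.closedBall 0 1) := by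
  -- The binomial series converges uniformly on the open ball of radius `r < 1`, which contains `t
  -- z` for all `|z| ≤ 1`.
  obtain ⟨r, hr, hr1⟩ := exists_between ht1
  have hr0 : 0 ≤ r := ht0.trans hr.le
  have h := (Complex.one_add_cpow_hasFPowerSeriesOnBall_zero (a := a)).tendstoUniformlyOn'
    (r' := ⟨r, hr0⟩) (ENNReal.coe_lt_one_iff.mpr hr1)
  have h2 := h.comp (fun z : ℂ => (t : ℂ) * z)
  refine ⟨fun N => ∑ j ∈ Finset.range N,
    C ((t : ℂ) ^ j * (binomialSeries ℂ a).coeff j) * X ^ j, ?_⟩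
  refine (h2.mono ?_).congr ?_
  · intro z hz
    have hz' : ‖z‖ ≤ 1 := by simpa using hz
    simp only [Set.mem_preimage, Metric.mem_ball, dist_zero_right, norm_mul, Complex.norm_real,
      Real.norm_of_nonneg ht0]
    exact lt_of_le_of_lt (mul_le_of_le_one_right ht0 hz') hr
  · refine Eventually.of_forall fun N z _ => ?_
    simp only [FormalMultilinearSeries.partialSum, Function.comp_apply, sub_zero,
      FormalMultilinearSeries.apply_eq_pow_smul_coeff, eval_finsetSum, eval_mul, eval_C, eval_pow,
      eval_X, smul_eq_mul]
    refine Finset.sum_congr rfl fun j _ => ?_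
    ring

theorem norm_one_add_mul_le {t : ℝ} (ht0 : 0 ≤ t) (ht1 : t ≤ 1) {w : ℂ} (hw : ‖w‖ ≤ 1) :
    ‖1 + (t : ℂ) * w‖ ≤ 2 := by
  refine (norm_add_le _ _).trans ?_
  rw [norm_one, norm_mul, Complex.norm_real, Real.norm_of_nonneg ht0]
  nlinarith [norm_nonneg w]

/-- Subordination for the means of `|1 + t z| ^ p`. -/
theorem circleAverage_norm_one_add_rpow_le {f : ℂ → ℂ} (hf : DiffContOnCl ℂ f (Metric.ball 0 1))
    (hf0 : f 0 = 0) (hf1 : ∀ z : ℂ, ‖z‖ = 1 → ‖f z‖ ≤ 1) {p : ℝ} (hp : 0 < p) {t : ℝ}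
    (ht0 : 0 ≤ t) (ht1 : t ≤ 1) :
    Real.circleAverage (fun z => ‖1 + (t : ℂ) * f z‖ ^ p) 0 1 ≤
      Real.circleAverage (fun z => ‖1 + (t : ℂ) * z‖ ^ p) 0 1 := by
  have hid : DiffContOnCl ℂ (fun z : ℂ => z) (Metric.ball 0 1) := differentiable_id.diffContOnCl
  have hcont : ∀ {h : ℂ → ℂ}, DiffContOnCl ℂ h (Metric.ball 0 1) → ∀ t : ℝ,
      ContinuousOn (fun z => ‖1 + (t : ℂ) * h z‖ ^ p) (Metric.sphere 0 1) := fun hh t =>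
    (continuousOn_const.add (continuousOn_const.mul hh.continuousOn_sphere)).norm.rpow_const
      (fun _ _ => Or.inr hp.le)
  have hlt : ∀ t ∈ Set.Ico (0 : ℝ) 1,
      Real.circleAverage (fun z => ‖1 + (t : ℂ) * f z‖ ^ p) 0 1 ≤
        Real.circleAverage (fun z => ‖1 + (t : ℂ) * z‖ ^ p) 0 1 := by
    rintro t ⟨ht0, ht1⟩
    -- The exponent `p/2` turns the `p`-th mean into a mean square.
    obtain ⟨g, hg⟩ := exists_polynomial_tendstoUniformlyOn_one_add_cpow ((p / 2 : ℝ) : ℂ) ht0 ht1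
    have hsq : ∀ w : ℂ, ‖(1 + (t : ℂ) * w) ^ ((p / 2 : ℝ) : ℂ)‖ ^ 2 = ‖1 + (t : ℂ) * w‖ ^ p := by
      intro w
      rw [Complex.norm_cpow_real, ← Real.rpow_natCast, ← Real.rpow_mul (norm_nonneg _)]
      congr 1
      push_cast
      ring
    have hlim : ∀ {h : ℂ → ℂ}, DiffContOnCl ℂ h (Metric.ball 0 1) →
        (∀ z : ℂ, ‖z‖ = 1 → ‖h z‖ ≤ 1) →
        Tendsto (fun N => Real.circleAverage (fun z => ‖(g N).eval (h z)‖ ^ 2) 0 1) atTop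
          (𝓝 (Real.circleAverage (fun z => ‖1 + (t : ℂ) * h z‖ ^ p) 0 1)) := by
      intro h hh hh1
      -- Eventually the polynomials are within `1` of a function bounded by `2 ^ (p / 2)`.
      refine tendsto_circleAverage_of_bounded ((2 ^ (p / 2) + 1) ^ 2) ?_ ?_ ?_
      · exact Eventually.of_forall fun N =>
          (hh.polynomial_eval (g N)).continuousOn_sphere.norm.pow 2
      · filter_upwards [Metric.tendstoUniformlyOn_iff.mp hg 1 one_pos] with N hN z hz
        have h1 := hN (h z) (by simpa using hh1 z hz)
        rw [dist_eq_norm] at h1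
        have h2 : ‖(1 + (t : ℂ) * h z) ^ ((p / 2 : ℝ) : ℂ)‖ ≤ 2 ^ (p / 2) := by
          rw [Complex.norm_cpow_real]
          exact Real.rpow_le_rpow (norm_nonneg _) (norm_one_add_mul_le ht0 ht1.le (hh1 z hz))
            (by positivity)
        have h3 := norm_le_norm_add_norm_sub' ((g N).eval (h z))
          ((1 + (t : ℂ) * h z) ^ ((p / 2 : ℝ) : ℂ))
        rw [norm_sub_rev] at h3
        rw [norm_pow, norm_norm]
        gcongr
        rw [norm_sub_rev] at h1 h3
        linarith
      · intro z hz
        rw [← hsq]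
        exact ((hg.tendsto_at (by simpa using hh1 z hz)).norm.pow 2)
    exact le_of_tendsto_of_tendsto' (hlim hf hf1) (hlim hid fun z hz => hz.le)
      (fun N => circleAverage_norm_eval_comp_sq_le hf hf0 hf1 (g N))
  rcases ht1.lt_or_eq with h | rfl
  · exact hlt t ⟨ht0, h⟩
  have hlim : ∀ {h : ℂ → ℂ}, DiffContOnCl ℂ h (Metric.ball 0 1) →
      (∀ z : ℂ, ‖z‖ = 1 → ‖h z‖ ≤ 1) →
      Tendsto (fun t : ℝ => Real.circleAverage (fun z => ‖1 + (t : ℂ) * h z‖ ^ p) 0 1) (𝓝[<] 1)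
        (𝓝 (Real.circleAverage (fun z => ‖1 + ((1 : ℝ) : ℂ) * h z‖ ^ p) 0 1)) := by
    intro h hh hh1
    refine tendsto_circleAverage_of_bounded (2 ^ p) ?_ ?_ ?_
    · exact Eventually.of_forall fun t => hcont hh t
    · filter_upwards [Ioo_mem_nhdsLT one_pos] with t ht z hz
      rw [Real.norm_of_nonneg (by positivity)]
      exact Real.rpow_le_rpow (norm_nonneg _)
        (norm_one_add_mul_le ht.1.le ht.2.le (hh1 z hz)) hp.le
    · intro z _
      have : Continuous fun t : ℝ => ‖1 + (t : ℂ) * h z‖ ^ p :=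
        (Continuous.norm (by fun_prop)).rpow_const (fun _ => Or.inr hp.le)
      exact (this.tendsto 1).mono_left nhdsWithin_le_nhds
  refine le_of_tendsto_of_tendsto (hlim hf hf1) (hlim hid fun z hz => hz.le) ?_
  filter_upwards [Ioo_mem_nhdsLT one_pos] with t ht using hlt t ⟨ht.1.le, ht.2⟩

/-! ### Maximum modulus as the limit of `L^p` means -/

theorem norm_eval_le_maxModulus (Q : ℂ[X]) {z : ℂ} (hz : ‖z‖ = 1) :
    ‖Q.eval z‖ ≤ maxModulus Q 1 :=
  (maxModulus_isGreatest Q zero_le_one).2 ⟨z, by simpa using hz, rfl⟩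

theorem exists_norm_eval_eq_maxModulus (Q : ℂ[X]) :
    ∃ z : ℂ, ‖z‖ = 1 ∧ ‖Q.eval z‖ = maxModulus Q 1 := by
  obtain ⟨z, hz, h⟩ := (maxModulus_isGreatest Q zero_le_one).1
  exact ⟨z, by simpa using hz, h⟩

theorem maxModulus_nonneg (Q : ℂ[X]) : 0 ≤ maxModulus Q 1 := by
  obtain ⟨z, -, h⟩ := exists_norm_eval_eq_maxModulus Q
  exact h ▸ norm_nonneg _

theorem minModulus_nonneg (Q : ℂ[X]) {r : ℝ} (hr : 0 ≤ r) : 0 ≤ minModulus Q r := by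
  obtain ⟨z, -, h⟩ := (minModulus_isLeast Q hr).1
  exact h ▸ norm_nonneg _

theorem maxModulus_one_add_C_mul_X {s : ℝ} (hs : 0 ≤ s) :
    maxModulus (1 + C (s : ℂ) * X) 1 = 1 + s := by
  refine (maxModulus_isGreatest _ zero_le_one).unique ⟨⟨1, by simp, ?_⟩, ?_⟩
  · simp only [eval_add, eval_one, eval_mul, eval_C, eval_X, mul_one]
    rw [← Complex.ofReal_one, ← Complex.ofReal_add, Complex.norm_real,
      Real.norm_of_nonneg (by positivity)]
  · rintro _ ⟨z, hz, rfl⟩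
    have hz : ‖z‖ = 1 := by simpa using hz
    simp only [eval_add, eval_one, eval_mul, eval_C, eval_X]
    refine (norm_add_le _ _).trans ?_
    rw [norm_one, norm_mul, hz, mul_one, Complex.norm_real, Real.norm_of_nonneg hs]

theorem continuous_norm_eval_rpow (Q : ℂ[X]) {p : ℝ} (hp : 0 ≤ p) :
    Continuous fun z : ℂ => ‖Q.eval z‖ ^ p :=
  Q.continuous.norm.rpow_const fun _ => Or.inr hp

theorem circleAverage_norm_eval_rpow_nonneg (p : ℝ) (Q : ℂ[X]) :
    0 ≤ Real.circleAverage (fun z => ‖Q.eval z‖ ^ p) 0 1 :=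
  Real.circleAverage_nonneg_of_nonneg fun _ _ => by positivity

theorem circleLp_eq_circleAverage (p : ℝ) (Q : ℂ[X]) :
    circleLp p Q = (2 * Real.pi) ^ (1 / p) *
      Real.circleAverage (fun z => ‖Q.eval z‖ ^ p) 0 1 ^ (1 / p) := by
  rw [← Real.mul_rpow Real.two_pi_pos.le (circleAverage_norm_eval_rpow_nonneg p Q), circleLp,
    Real.circleAverage, smul_eq_mul, mul_inv_cancel_left₀ Real.two_pi_pos.ne']
  simp only [circleMap_zero, Complex.ofReal_one, one_mul]

theorem circleLp_nonneg (p : ℝ) (Q : ℂ[X]) : 0 ≤ circleLp p Q := by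
  rw [circleLp_eq_circleAverage]
  have := circleAverage_norm_eval_rpow_nonneg p Q
  have := Real.two_pi_pos
  positivity

/-- The mean of `|Q| ^ p` over the unit circle is at least a fixed positive multiple of `b ^ p`, for
every `b` below the maximum of `|Q|`. -/
theorem exists_pos_mul_rpow_le_circleAverage (Q : ℂ[X]) {b : ℝ} (hb0 : 0 ≤ b)
    (hb : b < maxModulus Q 1) :
    ∃ κ : ℝ, 0 < κ ∧ ∀ p : ℝ, 0 < p →
      κ * b ^ p ≤ Real.circleAverage (fun z => ‖Q.eval z‖ ^ p) 0 1 := by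
  set M := maxModulus Q 1 with hM
  -- `φ` vanishes where `|Q| ≤ b` and is at most `1` on the circle, so `b^p φ ≤ |Q|^p` there. Its
  -- mean `κ` is positive because `φ = 1` at a maximum point of `|Q|`.
  set φ : ℂ → ℝ := fun z => max 0 (‖Q.eval z‖ - b) / (M - b) with hφ
  have hMb : 0 < M - b := sub_pos.mpr hb
  have hφc : Continuous φ := by
    have := Q.continuous
    fun_prop
  have hφ0 : ∀ z, 0 ≤ φ z := fun z => by positivity
  refine ⟨Real.circleAverage φ 0 1, ?_, fun p hp => ?_⟩
  · obtain ⟨z, hz, hzM⟩ := exists_norm_eval_eq_maxModulus Q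
    have hz' : z ∈ circleMap 0 1 '' Set.Ioc 0 (2 * Real.pi) := by
      rw [image_circleMap_Ioc, abs_one]
      simpa using hz
    obtain ⟨θ, hθ, rfl⟩ := hz'
    rw [Real.circleAverage, smul_eq_mul]
    refine mul_pos (inv_pos.mpr Real.two_pi_pos) ?_
    refine intervalIntegral.integral_pos Real.two_pi_pos
      (hφc.comp (continuous_circleMap 0 1)).continuousOn (fun _ _ => hφ0 _)
      ⟨θ, Set.Ioc_subset_Icc_self hθ, ?_⟩
    simp only [hφ, hzM]
    have : 0 < max 0 (M - b) := lt_max_of_lt_right hMb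
    positivity
  · rw [mul_comm, ← smul_eq_mul, ← Real.circleAverage_fun_smul]
    refine circleAverage_le_of_le_on_sphere
      (by simpa only [smul_eq_mul] using! (continuous_const.mul hφc).continuousOn)
      (continuous_norm_eval_rpow Q hp.le).continuousOn (fun z hz => ?_)
    rcases le_total ‖Q.eval z‖ b with h | h
    · simp only [hφ, max_eq_left (sub_nonpos.mpr h), zero_div, smul_zero]
      positivity
    · have h1 : φ z ≤ 1 := by
        rw [hφ, div_le_one hMb, max_le_iff]
        exact ⟨hMb.le, by linarith [norm_eval_le_maxModulus Q hz]⟩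
      calc b ^ p * φ z ≤ b ^ p := mul_le_of_le_one_right (by positivity) h1
        _ ≤ ‖Q.eval z‖ ^ p := by gcongr

/-- The normalized `L^p` means over the unit circle converge to the maximum modulus. -/
theorem tendsto_circleAverage_rpow_maxModulus (Q : ℂ[X]) :
    Tendsto (fun p : ℝ => Real.circleAverage (fun z => ‖Q.eval z‖ ^ p) 0 1 ^ (1 / p)) atTop
      (𝓝 (maxModulus Q 1)) := by
  refine tendsto_order.mpr ⟨fun a ha => ?_, fun a ha => ?_⟩
  · rcases lt_or_ge a 0 with h0 | h0
    · exact Eventually.of_forall fun p =>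
        h0.trans_le (Real.rpow_nonneg (circleAverage_norm_eval_rpow_nonneg p Q) _)
    obtain ⟨b, hab, hbM⟩ := exists_between ha
    have hb0 : 0 < b := h0.trans_lt hab
    obtain ⟨κ, hκ, h⟩ := exists_pos_mul_rpow_le_circleAverage Q hb0.le hbM
    have hlim : Tendsto (fun p : ℝ => κ ^ (1 / p) * b) atTop (𝓝 (κ ^ (0 : ℝ) * b)) := by
      refine Tendsto.mul_const b (tendsto_const_nhds.rpow ?_ (Or.inl hκ.ne'))
      exact tendsto_inv_atTop_zero.congr fun p : ℝ => (one_div p).symm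
    rw [Real.rpow_zero, one_mul] at hlim
    filter_upwards [hlim.eventually_const_lt hab, eventually_gt_atTop 0] with p hp hp0
    refine hp.trans_le ?_
    calc κ ^ (1 / p) * b = (κ * b ^ p) ^ (1 / p) := by
          rw [Real.mul_rpow hκ.le (by positivity), ← Real.rpow_mul hb0.le, mul_one_div_cancel hp0.ne',
            Real.rpow_one]
      _ ≤ _ := Real.rpow_le_rpow (by positivity) (h p hp0) (by positivity)
  · filter_upwards [eventually_gt_atTop 0] with p hp0
    refine lt_of_le_of_lt ?_ ha
    have : Real.circleAverage (fun z => ‖Q.eval z‖ ^ p) 0 1 ≤ maxModulus Q 1 ^ p := by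
      refine Real.circleAverage_mono_on_of_le_circle
        ((continuous_norm_eval_rpow Q hp0.le).continuousOn.circleIntegrable zero_le_one)
        (fun z hz => ?_)
      exact Real.rpow_le_rpow (norm_nonneg _) (norm_eval_le_maxModulus Q (by simpa using hz)) hp0.le
    calc _ ≤ (maxModulus Q 1 ^ p) ^ (1 / p) :=
          Real.rpow_le_rpow (circleAverage_norm_eval_rpow_nonneg p Q) this (by positivity)
      _ = maxModulus Q 1 := by
          rw [← Real.rpow_mul (maxModulus_nonneg Q), mul_one_div_cancel hp0.ne', Real.rpow_one]

theorem tendsto_two_pi_rpow_mul_circleLp (Q : ℂ[X]) :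
    Tendsto (fun p : ℝ => (2 * Real.pi) ^ (-(1 / p)) * circleLp p Q) atTop
      (𝓝 (maxModulus Q 1)) := by
  refine (tendsto_circleAverage_rpow_maxModulus Q).congr fun p => ?_
  rw [circleLp_eq_circleAverage, ← mul_assoc, ← Real.rpow_add Real.two_pi_pos, neg_add_cancel,
    Real.rpow_zero, one_mul]

/-! ### Cancelling boundary zeros and the mean of `A + zB` -/

/-- A connected set with more than one point has no isolated point. This extends an inequality by
continuity to a cancelled zero. -/
theorem mem_closure_sphere_diff_singleton {ζ : ℂ} (hζ : ‖ζ‖ = 1) :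
    ζ ∈ closure (Metric.sphere (0 : ℂ) 1 \ {ζ}) := by
  have hpre : IsPreconnected (Metric.sphere (0 : ℂ) 1) :=
    isPreconnected_sphere (by rw [Complex.rank_real_complex]; norm_num) 0 1
  have hnt : (Metric.sphere (0 : ℂ) 1).Nontrivial :=
    ⟨1, by simp, -1, by simp, by norm_num⟩
  have := hpre.preperfect_of_nontrivial hnt ζ (by simpa using hζ)
  rwa [accPt_principal_iff_clusterPt, ← mem_closure_iff_clusterPt] at this

/-- Common zeros on the unit circle can be cancelled in an inequality `|B| ≤ s |A|`. -/
theorem exists_mul_eq_and_forall_ne_zero {A B : ℂ[X]} {s : ℝ}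
    (hA : ∀ z : ℂ, ‖z‖ < 1 → A.eval z ≠ 0)
    (hAB : ∀ z : ℂ, ‖z‖ = 1 → ‖B.eval z‖ ≤ s * ‖A.eval z‖) :
    ∃ D A₀ B₀ : ℂ[X], A = D * A₀ ∧ B = D * B₀ ∧ (∀ z : ℂ, ‖z‖ ≤ 1 → A₀.eval z ≠ 0) ∧
      ∀ z : ℂ, ‖z‖ = 1 → ‖B₀.eval z‖ ≤ s * ‖A₀.eval z‖ := by
  induction hN : A.natDegree using Nat.strong_induction_on generalizing A B with
  | _ N ih =>
    by_cases hcirc : ∀ z : ℂ, ‖z‖ = 1 → A.eval z ≠ 0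
    · refine ⟨1, A, B, (one_mul _).symm, (one_mul _).symm, fun z hz => ?_, hAB⟩
      exact hz.lt_or_eq.elim (hA z) (hcirc z)
    push Not at hcirc
    obtain ⟨ζ, hζ, hAζ⟩ := hcirc
    -- The inequality forces every zero of `A` on the circle to be a zero of `B`; dividing both by
    -- `X - ζ` lowers the degree of `A`.
    have hBζ : B.eval ζ = 0 := by
      have := hAB ζ hζ
      rwa [hAζ, norm_zero, mul_zero, norm_le_zero_iff] at this
    obtain ⟨A', rfl⟩ := dvd_iff_isRoot.mpr hAζ
    obtain ⟨B', rfl⟩ := dvd_iff_isRoot.mpr hBζ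
    have hA' : ∀ z : ℂ, ‖z‖ < 1 → A'.eval z ≠ 0 := fun z hz h => hA z hz (by
      rw [eval_mul, h, mul_zero])
    have hA'0 : A' ≠ 0 := by
      rintro rfl
      exact hA' 0 (by simp) eval_zero
    have hAB' : ∀ z : ℂ, ‖z‖ = 1 → ‖B'.eval z‖ ≤ s * ‖A'.eval z‖ := by
      have hclosed : IsClosed {z : ℂ | ‖B'.eval z‖ ≤ s * ‖A'.eval z‖} :=
        isClosed_le B'.continuous.norm (continuous_const.mul A'.continuous.norm)
      have hne : ∀ z : ℂ, ‖z‖ = 1 → z ≠ ζ → ‖B'.eval z‖ ≤ s * ‖A'.eval z‖ := by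
        intro z hz hzζ
        have h := hAB z hz
        rw [eval_mul, eval_mul, norm_mul, norm_mul, mul_left_comm] at h
        refine le_of_mul_le_mul_left h (norm_pos_iff.mpr ?_)
        simpa [sub_eq_zero] using hzζ
      intro z hz
      rcases eq_or_ne z ζ with rfl | hzζ
      · exact hclosed.closure_subset_iff.mpr
          (fun w hw => hne w (by simpa using hw.1) hw.2) (mem_closure_sphere_diff_singleton hz)
      · exact hne z hz hzζ
    obtain ⟨D, A₀, B₀, rfl, rfl, h1, h2⟩ := ih A'.natDegree (by
      rw [← hN, natDegree_mul (X_sub_C_ne_zero ζ) hA'0, natDegree_X_sub_C]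
      omega) hA' hAB' rfl
    exact ⟨(X - C ζ) * D, A₀, B₀, (mul_assoc _ _ _).symm, (mul_assoc _ _ _).symm, h1, h2⟩

/-- On the circle `A + zB = A (1 + s f)` with `f = zB / (sA)`, which vanishes at `0` and is bounded
by `1` there. Cancelling common zeros makes `f` holomorphic across the circle, so subordination
applies. -/
theorem circleAverage_norm_add_mul_rpow_le {A B : ℂ[X]} {s K p : ℝ} (hs0 : 0 < s) (hs1 : s ≤ 1)
    (hp : 0 < p) (hA : ∀ z : ℂ, ‖z‖ < 1 → A.eval z ≠ 0)
    (hAB : ∀ z : ℂ, ‖z‖ = 1 → ‖B.eval z‖ ≤ s * ‖A.eval z‖)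
    (hK : ∀ z : ℂ, ‖z‖ = 1 → ‖A.eval z‖ ≤ K) :
    Real.circleAverage (fun z => ‖(A + X * B).eval z‖ ^ p) 0 1 ≤
      K ^ p * Real.circleAverage (fun z => ‖1 + (s : ℂ) * z‖ ^ p) 0 1 := by
  obtain ⟨D, A₀, B₀, rfl, rfl, hA₀, hAB₀⟩ := exists_mul_eq_and_forall_ne_zero hA hAB
  have hK0 : 0 ≤ K := (norm_nonneg _).trans (hK 1 norm_one)
  have hsC : (s : ℂ) ≠ 0 := by exact_mod_cast hs0.ne'
  set f : ℂ → ℂ := fun z => z * (B₀.eval z / (s * A₀.eval z)) with hf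
  have hfd : DiffContOnCl ℂ f (Metric.ball 0 1) := by
    apply DifferentiableOn.diffContOnCl
    rw [closure_ball _ one_ne_zero]
    intro w hw
    refine (differentiableAt_id.mul (B₀.differentiable.differentiableAt.div
      (A₀.differentiable.differentiableAt.const_mul _)
      (mul_ne_zero hsC (hA₀ w (by simpa using hw))))).differentiableWithinAt
  have hf1 : ∀ z : ℂ, ‖z‖ = 1 → ‖f z‖ ≤ 1 := by
    intro z hz
    rw [hf]
    simp only
    rw [norm_mul, hz, one_mul, norm_div, norm_mul, Complex.norm_real, Real.norm_of_nonneg hs0.le]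
    exact div_le_one_of_le₀ (hAB₀ z hz) (by positivity)
  have hsub := circleAverage_norm_one_add_rpow_le hfd (by simp [hf]) hf1 hp hs0.le hs1
  have hcf : ContinuousOn (fun z => ‖1 + (s : ℂ) * f z‖ ^ p) (Metric.sphere 0 1) :=
    (continuousOn_const.add (continuousOn_const.mul hfd.continuousOn_sphere)).norm.rpow_const
      (fun _ _ => Or.inr hp.le)
  calc _ ≤ Real.circleAverage (fun z => K ^ p • ‖1 + (s : ℂ) * f z‖ ^ p) 0 1 := by
        refine circleAverage_le_of_le_on_sphere (continuous_norm_eval_rpow _ hp.le).continuousOn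
          (by simpa only [smul_eq_mul] using! continuousOn_const.mul hcf) (fun z hz => ?_)
        have hA₀z := hA₀ z hz.le
        have : (D * A₀ + X * (D * B₀)).eval z = (D * A₀).eval z * (1 + s * f z) := by
          simp only [eval_add, eval_mul, eval_X, hf]
          field_simp
        rw [this, norm_mul, Real.mul_rpow (norm_nonneg _) (norm_nonneg _), smul_eq_mul]
        have := hK z hz
        gcongr
    _ = K ^ p * Real.circleAverage (fun z => ‖1 + (s : ℂ) * f z‖ ^ p) 0 1 := by
        rw [Real.circleAverage_fun_smul, smul_eq_mul]
    _ ≤ _ := by gcongr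

/-! ### The reflected polynomial and the pointwise bound -/

theorem eval_reflect {n : ℕ} {R : ℂ[X]} (hR : R.natDegree ≤ n) {z : ℂ} (hz : z ≠ 0) :
    (reflect n R).eval z = z ^ n * R.eval z⁻¹ := by
  let _ : Invertible z⁻¹ := invertibleOfNonzero (inv_ne_zero hz)
  have h := eval₂_reflect_mul_pow (RingHom.id ℂ) z⁻¹ n R hR
  rw [invOf_eq_inv, inv_inv] at h
  rw [eval, eval, ← h, mul_comm, mul_assoc, ← mul_pow, inv_mul_cancel₀ hz, one_pow, mul_one]

/-- Up to the factor `z^n` and inversion of the point, reflection interchanges `zR'` and `nR - zR'`.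
-/
theorem mul_eval_derivative_reflect {n : ℕ} {R : ℂ[X]} (hR : R.natDegree ≤ n) {z : ℂ}
    (hz : z ≠ 0) :
    z * (derivative (reflect n R)).eval z =
      z ^ n * (n * R.eval z⁻¹ - z⁻¹ * (derivative R).eval z⁻¹) := by
  have h1 := (reflect n R).hasDerivAt z
  have h2 := (hasDerivAt_pow n z).mul ((R.hasDerivAt z⁻¹).comp z (hasDerivAt_inv hz))
  have h3 : (fun w => (reflect n R).eval w) =ᶠ[𝓝 z]
      (fun w : ℂ => w ^ n) * ((fun w => R.eval w) ∘ Inv.inv) := by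
    filter_upwards [isOpen_ne.mem_nhds hz] with w hw using eval_reflect hR hw
  rw [h1.unique (h2.congr_of_eventuallyEq h3)]
  rcases n with _ | n
  · simp
    field_simp
  · simp only [Nat.add_sub_cancel, Function.comp_apply]
    field_simp
    ring

theorem mul_eval_reflect_sub_mul_eval_derivative {n : ℕ} {R : ℂ[X]} (hR : R.natDegree ≤ n) {z : ℂ}
    (hz : z ≠ 0) :
    n * (reflect n R).eval z - z * (derivative (reflect n R)).eval z =
      z ^ n * (z⁻¹ * (derivative R).eval z⁻¹) := by
  rw [mul_eval_derivative_reflect hR hz, eval_reflect hR hz]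
  ring

/-- Nonzero zeros of the reflection are inverses of zeros of `R`, and its value at `0` is the
leading coefficient. -/
theorem eval_reflect_ne_zero {R : ℂ[X]} (hR0 : R ≠ 0) {k : ℝ} (hk : k ≤ 1)
    (hroots : ∀ z : ℂ, R.IsRoot z → ‖z‖ ≤ k) {z : ℂ} (hz : ‖z‖ < 1) :
    (reflect R.natDegree R).eval z ≠ 0 := by
  rcases eq_or_ne z 0 with rfl | h0
  · rw [← coeff_zero_eq_eval_zero, coeff_reflect, revAt_zero]
    exact leadingCoeff_ne_zero.mpr hR0
  · rw [eval_reflect le_rfl h0]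
    refine mul_ne_zero (pow_ne_zero _ h0) fun h => ?_
    have h1 := (hroots _ h).trans hk
    rw [norm_inv] at h1
    exact absurd h1 (not_le.mpr ((one_lt_inv₀ (norm_pos_iff.mpr h0)).mpr hz))

/-- If all zeros of `P` lie in `|z| ≤ k` and `P` has a gap of length `μ` below its leading term,
then `|n P - z P'|` is controlled by `k ^ μ |P'|` on the unit circle. -/
theorem norm_natDegree_mul_sub_add_le {P : ℂ[X]} {n μ : ℕ} (hn : n ≠ 0) (hμn : μ ≤ n)
    (hdeg : P.natDegree = n) (hgap : ∀ j, 0 < j → j < μ → P.coeff (n - j) = 0)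
    {k : ℝ} (hk0 : 0 < k) (hk1 : k ≤ 1) (hroots : ∀ z : ℂ, P.IsRoot z → ‖z‖ ≤ k)
    {v : ℂ} (hv : ‖v‖ = 1) :
    ‖n * P.eval v - v * (derivative P).eval v‖ + n * (minModulus P k / k ^ (n - μ)) ≤
      k ^ μ * ‖(derivative P).eval v‖ := by
  set m := minModulus P k with hm
  have hkC : (k : ℂ) ≠ 0 := by exact_mod_cast hk0.ne'
  have hv0 : v ≠ 0 := norm_pos_iff.mp (by rw [hv]; exact one_pos)
  -- Rescaling carries `|z| = k` to the unit circle, where the reflection of `R` is then bounded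
  -- below by `m`.
  set R := P.comp (C (k : ℂ) * X) with hR
  have hRc : ∀ j, R.coeff j = P.coeff j * (k : ℂ) ^ j := fun j => by
    rw [hR, comp_C_mul_X_coeff]
  have hRe : ∀ z, R.eval z = P.eval (k * z) := fun z => by simp [hR]
  have hRd : ∀ z, (derivative R).eval z = k * (derivative P).eval (k * z) := fun z => by
    simp [hR, derivative_comp]
  have hRdeg : R.natDegree = n := by
    rw [hR, natDegree_comp, hdeg, natDegree_C_mul_X _ hkC, mul_one]
  have hR0 : R ≠ 0 := by
    rintro h
    rw [h, natDegree_zero] at hRdeg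
    exact hn hRdeg.symm
  have hRroots : ∀ z : ℂ, R.IsRoot z → ‖z‖ ≤ 1 := by
    intro z hz
    have : ‖(k : ℂ) * z‖ ≤ k := hroots _ (by rw [IsRoot, ← hRe]; exact hz)
    rw [norm_mul, Complex.norm_real, Real.norm_of_nonneg hk0.le] at this
    exact le_of_mul_le_mul_left (by rwa [mul_one]) hk0
  have hG : ∀ z : ℂ, ‖z‖ < 1 → (reflect n R).eval z ≠ 0 := fun z hz => by
    have := eval_reflect_ne_zero hR0 le_rfl hRroots hz
    rwa [hRdeg] at this
  have hGdeg : (reflect n R).natDegree ≤ n := by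
    have := natDegree_reflect_le (N := n) (p := R)
    rwa [hRdeg, max_self] at this
  have hGgap : ∀ j, 0 < j → j < μ → (reflect n R).coeff j = 0 := by
    intro j hj hjμ
    rw [coeff_reflect, revAt_le (hjμ.le.trans hμn), hRc, hgap j hj hjμ, zero_mul]
  have hGm : ∀ z : ℂ, ‖z‖ = 1 → m ≤ ‖(reflect n R).eval z‖ := by
    intro z hz
    have hz0 : z ≠ 0 := norm_pos_iff.mp (by rw [hz]; exact one_pos)
    rw [eval_reflect hRdeg.le hz0, norm_mul, norm_pow, hz, one_pow, one_mul, hRe]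
    exact (minModulus_isLeast P hk0.le).2 ⟨k * z⁻¹, by simp [hz, abs_of_pos hk0], rfl⟩
  have hz0 : (k : ℂ) * v⁻¹ ≠ 0 := mul_ne_zero hkC (inv_ne_zero hv0)
  have hznorm : ‖(k : ℂ) * v⁻¹‖ = k := by simp [hv, abs_of_pos hk0]
  have hzinv : (k : ℂ) * ((k : ℂ) * v⁻¹)⁻¹ = v := by
    field_simp
  -- At the point `k/v`, of modulus `k`, the reflection of `R` involves `P` and `P'` at `v` itself,
  -- and `|z|^μ` becomes `k^μ`.
  have key := norm_mul_derivative_le_pow_mul_sub hn hGdeg hG hGgap (minModulus_nonneg P hk0.le) hGm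
    (z := k * v⁻¹) (hznorm.trans_le hk1)
  rw [mul_eval_reflect_sub_mul_eval_derivative hRdeg.le hz0,
    mul_eval_derivative_reflect hRdeg.le hz0, hRe, hRd, hzinv, ← mul_assoc _ (k : ℂ),
    mul_comm _ (k : ℂ), hzinv, norm_mul (((k : ℂ) * v⁻¹) ^ n), norm_mul (((k : ℂ) * v⁻¹) ^ n),
    norm_mul v, norm_pow, hznorm, hv, one_mul] at key
  have hpow : k ^ n = k ^ μ * k ^ (n - μ) := by rw [← pow_add, Nat.add_sub_cancel' hμn]
  have hkμ : 0 < k ^ μ := by positivity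
  have hkn : 0 < k ^ (n - μ) := by positivity
  have h2 : ‖n * P.eval v - v * (derivative P).eval v‖ * k ^ (n - μ) ≤
      k ^ n * ‖(derivative P).eval v‖ - n * m := by
    refine le_of_mul_le_mul_left ?_ hkμ
    calc _ = k ^ n * ‖n * P.eval v - v * (derivative P).eval v‖ := by rw [hpow]; ring
      _ ≤ _ := key
  rw [hpow] at h2
  have h3 : (‖n * P.eval v - v * (derivative P).eval v‖ + n * (m / k ^ (n - μ))) * k ^ (n - μ) ≤
      (k ^ μ * ‖(derivative P).eval v‖) * k ^ (n - μ) := by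
    rw [add_mul, mul_assoc, div_mul_cancel₀ _ hkn.ne']
    linarith
  exact le_of_mul_le_mul_right h3 hkn

/-! ### Integral mean inequality and its consequences -/

/-- With `F` the reflection of `P`, `n(F + c z^n)` is `A + zB` for `A = nF - zF'` and `zB = zF' + n
c z^n`. Placing `c` in `B` keeps `A` free of zeros in the disc, and the hypothesis on `c` is what
gives `|B| ≤ s|A|`. -/
theorem natCast_mul_circleLp_add_C_le {P : ℂ[X]} {n : ℕ} {s K p : ℝ} {c : ℂ} (hn : n ≠ 0)
    (hdeg : P.natDegree = n) (hroots : ∀ z : ℂ, P.IsRoot z → ‖z‖ ≤ 1)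
    (hs0 : 0 < s) (hs1 : s ≤ 1) (hp : 0 < p)
    (hc : ∀ v : ℂ, ‖v‖ = 1 → ‖n * P.eval v - v * (derivative P).eval v‖ + n * ‖c‖ ≤
      s * ‖(derivative P).eval v‖)
    (hK : ∀ v : ℂ, ‖v‖ = 1 → ‖(derivative P).eval v‖ ≤ K) :
    n * circleLp p (P + C c) ≤ circleLp p (1 + C (s : ℂ) * X) * K := by
  have hP0 : P ≠ 0 := by
    rintro rfl
    exact hn (hdeg.symm.trans natDegree_zero)
  have hK0 : 0 ≤ K := (norm_nonneg _).trans (hK 1 norm_one)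
  set F := reflect n P with hF
  have hFne : ∀ z : ℂ, ‖z‖ < 1 → F.eval z ≠ 0 := fun z hz => by
    have := eval_reflect_ne_zero hP0 le_rfl hroots hz
    rwa [hdeg] at this
  have hFdeg : F.natDegree ≤ n := by
    have := natDegree_reflect_le (N := n) (p := P)
    rwa [hdeg, max_self] at this
  set A := C (n : ℂ) * F - X * derivative F with hA
  set B := derivative F + C (n * c) * X ^ (n - 1) with hB
  have hAe : ∀ z, A.eval z = n * F.eval z - z * (derivative F).eval z := fun z => by simp [hA]
  have hXB : ∀ z, z * B.eval z = z * (derivative F).eval z + n * c * z ^ n := fun z => by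
    obtain ⟨n, rfl⟩ := Nat.exists_eq_succ_of_ne_zero hn
    simp only [hB, eval_add, eval_mul, eval_C, eval_pow, eval_X, Nat.succ_sub_one, pow_succ]
    ring
  have hne : ∀ z : ℂ, ‖z‖ = 1 → z ≠ 0 := fun z hz => norm_pos_iff.mp (by rw [hz]; exact one_pos)
  have hAn : ∀ z : ℂ, ‖z‖ = 1 → ‖A.eval z‖ = ‖(derivative P).eval z⁻¹‖ := fun z hz => by
    rw [hAe, mul_eval_reflect_sub_mul_eval_derivative hdeg.le (hne z hz)]
    simp [hz]
  have hinv : ∀ z : ℂ, ‖z‖ = 1 → ‖z⁻¹‖ = 1 := fun z hz => by rw [norm_inv, hz, inv_one]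
  have hAB : ∀ z : ℂ, ‖z‖ = 1 → ‖B.eval z‖ ≤ s * ‖A.eval z‖ := by
    intro z hz
    have h1 : ‖B.eval z‖ = ‖z * B.eval z‖ := by rw [norm_mul, hz, one_mul]
    rw [hAn z hz, h1, hXB, mul_eval_derivative_reflect hdeg.le (hne z hz)]
    refine (norm_add_le _ _).trans (le_of_eq_of_le ?_ (hc _ (hinv z hz)))
    simp only [norm_mul, norm_pow, hz, one_pow, one_mul, mul_one, Complex.norm_natCast]
  have hsum : ∀ z : ℂ, ‖z‖ = 1 → ‖(A + X * B).eval z‖ = n * ‖(P + C c).eval z⁻¹‖ := by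
    intro z hz
    have : (A + X * B).eval z = z ^ n * (n * (P + C c).eval z⁻¹) := by
      rw [eval_add, eval_mul, eval_X, hXB, hAe, eval_reflect hdeg.le (hne z hz), eval_add, eval_C]
      ring
    rw [this, norm_mul, norm_mul, norm_pow, hz, one_pow, one_mul, Complex.norm_natCast]
  have main := circleAverage_norm_add_mul_rpow_le hs0 hs1 hp (A := A) (B := B)
    (fun z hz => by
      rw [hAe]
      exact natCast_mul_sub_mul_derivative_ne_zero hn hFdeg hFne hz) hAB
    (fun z hz => by
      rw [hAn z hz]
      exact hK _ (hinv z hz))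
  have hleft : Real.circleAverage (fun z => ‖(A + X * B).eval z‖ ^ p) 0 1 =
      (n : ℝ) ^ p * Real.circleAverage (fun z => ‖(P + C c).eval z‖ ^ p) 0 1 := by
    -- The reflection evaluates `P + c` at `1/z`; inversion preserves the average over the unit
    -- circle.
    rw [← Real.circleAverage_zero_one_congr_inv (f := fun z => ‖(P + C c).eval z‖ ^ p),
      ← smul_eq_mul ((n : ℝ) ^ p), ← Real.circleAverage_fun_smul]
    refine Real.circleAverage_congr_sphere fun z hz => ?_
    rw [hsum z (by simpa using hz), Real.mul_rpow (Nat.cast_nonneg n) (norm_nonneg _), smul_eq_mul]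
  have hright : (fun z : ℂ => ‖1 + (s : ℂ) * z‖ ^ p) =
      fun z => ‖(1 + C (s : ℂ) * X).eval z‖ ^ p := by simp
  rw [hleft, hright] at main
  have h0 := circleAverage_norm_eval_rpow_nonneg p (P + C c)
  have h1 := circleAverage_norm_eval_rpow_nonneg p (1 + C (s : ℂ) * X)
  have hroot := Real.rpow_le_rpow (by positivity) main (one_div_nonneg.mpr hp.le)
  rw [Real.mul_rpow (by positivity) h0, Real.mul_rpow (by positivity) h1,
    ← Real.rpow_mul (Nat.cast_nonneg n), ← Real.rpow_mul hK0, mul_one_div_cancel hp.ne',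
    Real.rpow_one, Real.rpow_one] at hroot
  rw [circleLp_eq_circleAverage, circleLp_eq_circleAverage]
  have hpi : 0 ≤ (2 * Real.pi) ^ (1 / p) := Real.rpow_nonneg Real.two_pi_pos.le _
  nlinarith [mul_le_mul_of_nonneg_left hroot hpi]

/-- The integral mean inequality for the polar derivative. -/
theorem circleLp_polarDeriv_le {P : ℂ[X]} {n μ : ℕ} (hn : n ≠ 0) (hμn : μ ≤ n)
    (hdeg : P.natDegree = n) (hgap : ∀ j, 0 < j → j < μ → P.coeff (n - j) = 0)
    {k : ℝ} (hk0 : 0 < k) (hk1 : k ≤ 1) (hroots : ∀ z : ℂ, P.IsRoot z → ‖z‖ ≤ k)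
    {α : ℂ} (hα : k ^ μ ≤ ‖α‖) {β : ℂ} (hβ : ‖β‖ ≤ 1) {p : ℝ} (hp : 0 < p) :
    n * (‖α‖ - k ^ μ) * circleLp p (P + C ((minModulus P k : ℂ) * β / (k : ℂ) ^ (n - μ))) ≤
      circleLp p (1 + C ((k : ℂ) ^ μ) * X) *
        (maxModulus (polarDeriv α P) 1 - n * minModulus P k / k ^ (n - μ)) := by
  set m := minModulus P k with hm
  have hm0 : 0 ≤ m := minModulus_nonneg P hk0.le
  have hpw := fun v hv => norm_natDegree_mul_sub_add_le hn hμn hdeg hgap hk0 hk1 hroots (v := v) hv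
  set T := maxModulus (polarDeriv α P) 1 - n * m / k ^ (n - μ) with hT
  have hTle : ∀ v : ℂ, ‖v‖ = 1 → (‖α‖ - k ^ μ) * ‖(derivative P).eval v‖ ≤ T := by
    intro v hv
    have h1 := norm_eval_le_maxModulus (polarDeriv α P) hv
    have h2 : (polarDeriv α P).eval v =
        α * (derivative P).eval v + (n * P.eval v - v * (derivative P).eval v) := by
      simp only [polarDeriv, hdeg, eval_add, eval_sub, eval_mul, eval_C, eval_X]
      ring
    have h3 := norm_sub_le_norm_add (α * (derivative P).eval v)
      (n * P.eval v - v * (derivative P).eval v)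
    rw [← h2, norm_mul] at h3
    have h4 := hpw v hv
    rw [← mul_div_assoc] at h4
    rw [hT]
    linarith
  have hC : C ((k : ℂ) ^ μ) = C ((k ^ μ : ℝ) : ℂ) := by push_cast; rfl
  rw [hC]
  -- If `|α| = k^μ`, division by `|α| - k^μ` is impossible; the left side is then zero and `hTle`
  -- gives `0 ≤ T`.
  rcases hα.eq_or_lt with h | h
  · rw [← h, sub_self, mul_zero, zero_mul]
    refine mul_nonneg (circleLp_nonneg _ _) ?_
    have := hTle 1 norm_one
    rwa [← h, sub_self, zero_mul] at this
  have hpos : 0 < ‖α‖ - k ^ μ := sub_pos.mpr h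
  have main := natCast_mul_circleLp_add_C_le (K := T / (‖α‖ - k ^ μ)) (s := k ^ μ) (p := p)
    (c := (m : ℂ) * β / (k : ℂ) ^ (n - μ)) hn hdeg
    (fun z hz => (hroots z hz).trans hk1) (by positivity) (pow_le_one₀ hk0.le hk1) hp
    (fun v hv => by
      refine le_trans ?_ (hpw v hv)
      rw [norm_div, norm_mul, norm_pow, Complex.norm_real, Complex.norm_real,
        Real.norm_of_nonneg hm0, Real.norm_of_nonneg hk0.le]
      gcongr
      exact mul_le_of_le_one_right hm0 hβ)
    (fun v hv => by
      rw [le_div_iff₀ hpos, mul_comm]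
      exact hTle v hv)
  rw [← mul_div_assoc, le_div_iff₀ hpos] at main
  linarith

theorem exists_norm_le_one_norm_add_mul (w : ℂ) {t : ℝ} (ht : 0 ≤ t) :
    ∃ β : ℂ, ‖β‖ ≤ 1 ∧ ‖w + t * β‖ = ‖w‖ + t := by
  rcases eq_or_ne w 0 with rfl | hw
  · exact ⟨1, by simp, by simp [abs_of_nonneg ht]⟩
  have hw' : (‖w‖ : ℂ) ≠ 0 := by exact_mod_cast norm_ne_zero_iff.mpr hw
  refine ⟨w / ‖w‖, by simp [hw], ?_⟩
  have : w + t * (w / ‖w‖) = ((‖w‖ + t : ℝ) : ℂ) * (w / ‖w‖) := by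
    push_cast
    field_simp
  rw [this, norm_mul, norm_div, Complex.norm_real, Complex.norm_real, norm_norm,
    div_self (norm_ne_zero_iff.mpr hw), mul_one, Real.norm_of_nonneg (by positivity)]

theorem corollary3 (n μ : ℕ) (hμ : 1 ≤ μ) (hμn : μ ≤ n)
    (a : ℕ → ℂ) (P : ℂ[X])
    (hP : P = C (a n) * X ^ n + ∑ j ∈ Finset.Icc μ n, C (a (n - j)) * X ^ (n - j))
    (hdeg : P.natDegree = n)
    (k : ℝ) (hk0 : 0 < k) (hk1 : k ≤ 1)
    (hroots : ∀ z : ℂ, P.IsRoot z → ‖z‖ ≤ k)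
    (m : ℝ) (hm : m = minModulus P k)
    (α : ℂ) (hα : k ^ μ ≤ ‖α‖) :
    -- the integral inequality
    (∀ β : ℂ, ‖β‖ ≤ 1 → ∀ p : ℝ, 0 < p →
      n * (‖α‖ - k ^ μ) * circleLp p (P + C ((m : ℂ) * β / (k : ℂ) ^ (n - μ))) ≤
        circleLp p (1 + C ((k : ℂ) ^ μ) * X) *
          (maxModulus (polarDeriv α P) 1 - n * m / k ^ (n - μ))) ∧
    -- the limits, as `p → ∞`, of its two sides after multiplication by `(2π)^(-1/p)`
    (∀ β : ℂ, ‖β‖ ≤ 1 →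
      Tendsto (fun p : ℝ => (2 * Real.pi) ^ (-(1 / p)) *
          (n * (‖α‖ - k ^ μ) * circleLp p (P + C ((m : ℂ) * β / (k : ℂ) ^ (n - μ))))) atTop
        (𝓝 (n * (‖α‖ - k ^ μ) * maxModulus (P + C ((m : ℂ) * β / (k : ℂ) ^ (n - μ))) 1)) ∧
      Tendsto (fun p : ℝ => (2 * Real.pi) ^ (-(1 / p)) *
          (circleLp p (1 + C ((k : ℂ) ^ μ) * X) *
            (maxModulus (polarDeriv α P) 1 - n * m / k ^ (n - μ)))) atTop
        (𝓝 ((1 + k ^ μ) * (maxModulus (polarDeriv α P) 1 - n * m / k ^ (n - μ)))) ∧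
      n * (‖α‖ - k ^ μ) * maxModulus (P + C ((m : ℂ) * β / (k : ℂ) ^ (n - μ))) 1 ≤
        (1 + k ^ μ) * (maxModulus (polarDeriv α P) 1 - n * m / k ^ (n - μ))) ∧
    -- the inequality in the maximum norm that results
    n * (‖α‖ - k ^ μ) * maxModulus P 1 + n * (‖α‖ - k) / k ^ (n - μ) * m ≤
      (1 + k ^ μ) * maxModulus (polarDeriv α P) 1 := by
  subst hm
  have hn : n ≠ 0 := by omega
  have hm0 := minModulus_nonneg P hk0.le
  have hgap : ∀ j, 0 < j → j < μ → P.coeff (n - j) = 0 := by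
    intro j hj hjμ
    rw [hP, coeff_add, coeff_C_mul_X_pow, if_neg (by omega), zero_add, finsetSum_coeff]
    refine Finset.sum_eq_zero fun i hi => ?_
    rw [Finset.mem_Icc] at hi
    rw [coeff_C_mul_X_pow, if_neg (by omega)]
  have hint := fun (β : ℂ) (hβ : ‖β‖ ≤ 1) (p : ℝ) (hp : 0 < p) =>
    circleLp_polarDeriv_le hn hμn hdeg hgap hk0 hk1 hroots hα hβ hp
  have hmax := fun (β : ℂ) (hβ : ‖β‖ ≤ 1) => by
    have hl := (tendsto_two_pi_rpow_mul_circleLp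
      (P + C ((minModulus P k : ℂ) * β / (k : ℂ) ^ (n - μ)))).const_mul (n * (‖α‖ - k ^ μ))
    have hr := (tendsto_two_pi_rpow_mul_circleLp (1 + C ((k ^ μ : ℝ) : ℂ) * X)).mul_const
      (maxModulus (polarDeriv α P) 1 - n * minModulus P k / k ^ (n - μ))
    rw [maxModulus_one_add_C_mul_X (by positivity), Complex.ofReal_pow] at hr
    replace hl := hl.congr fun _ => mul_left_comm _ _ _
    replace hr := hr.congr fun _ => mul_assoc _ _ _
    refine And.intro hl (And.intro hr (le_of_tendsto_of_tendsto hl hr ?_))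
    filter_upwards [eventually_gt_atTop 0] with p hp
    exact mul_le_mul_of_nonneg_left (hint β hβ p hp) (Real.rpow_nonneg Real.two_pi_pos.le _)
  refine ⟨hint, hmax, ?_⟩
  obtain ⟨z, hz, hzM⟩ := exists_norm_eval_eq_maxModulus P
  set t := minModulus P k / k ^ (n - μ) with ht
  have ht0 : 0 ≤ t := by positivity
  -- `β` is aligned with `P(z)` at a maximum point, so the perturbation adds exactly `t` to `max
  -- |P|`.
  obtain ⟨β, hβ, hβt⟩ := exists_norm_le_one_norm_add_mul (P.eval z) ht0
  have h1 := (hmax β hβ).2.2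
  have h2 := norm_eval_le_maxModulus (P + C ((minModulus P k : ℂ) * β / (k : ℂ) ^ (n - μ))) hz
  have h3 : (minModulus P k : ℂ) * β / (k : ℂ) ^ (n - μ) = t * β := by
    rw [ht]
    push_cast
    ring
  rw [eval_add, eval_C, h3, hβt, hzM] at h2
  rw [h3, mul_div_assoc, ← ht] at h1
  have h4 : n * (‖α‖ - k) / k ^ (n - μ) * minModulus P k = n * (‖α‖ - k) * t := by
    rw [ht]
    ring
  rw [h4]
  have hα' : 0 ≤ n * (‖α‖ - k ^ μ) := mul_nonneg (Nat.cast_nonneg n) (sub_nonneg.mpr hα)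
  have h5 := mul_le_mul_of_nonneg_left h2 hα'
  have hnt : 0 ≤ n * t := mul_nonneg (Nat.cast_nonneg n) ht0
  -- Collecting the terms in `t` gives `n t (|α| + 1)`, which is at least the required `n t (|α| -
  -- k)`.
  nlinarith [mul_nonneg hnt hk0.le]
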